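/- All vector spaces are finite-dimensional over a field $\mathbb K$ of characteristic $0$. A Lie–Yamaguti algebra is a vector space $\mathfrak g$ with a bilinear bracket $[\cdot,\cdot]:\wedge^2\mathfrak g\to\mathfrak g$ and a trilinear bracket $[\![\cdot,\cdot,\cdot]\!]:\wedge^2\mathfrak g\otimes\mathfrak g\to\mathfrak g$ such that $[[x,y],z]+[\![x,y,z]\!]+\text{cyclic}(x,y,z)=0$, $\;[\![[x,y],z,w]\!]+\text{cyclic}(x,y,z)=0$, and each operator $[\![x,y,\cdot]\!]$ is a derivation of both brackets. A homomorphism is a linear map preserving both brackets. The center $C(\mathfrak g)$ is the set of $x$ with $[x,\cdot]=0$ and ($[\![x,\cdot,\cdot]\!]=0$ or $[\![\cdot,x,\cdot]\!]=0$). A representation of $\mathfrak g$ on $V$ is a linear map $\rho:\mathfrak g\to\mathfrak{gl}(V)$ and a bilinear map $\mu:\otimes^2\mathfrak g\to\mathfrak{gl}(V)$ such that, with $D(x,y)=\mu(y,x)-\mu(x,y)+[\rho(x),\rho(y)]-\rho([x,y])$, $$\mu([x,y],z)-\mu(x,z)\rho(y)+\mu(y,z)\rho(x)=0,\qquad \mu(x,[y,z])-\rho(y)\mu(x,z)+\rho(z)\mu(x,y)=0,$$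 $$\rho([\![x,y,z]\!])=[D(x,y),\rho(z)],\qquad \mu([\![x,y,z]\!],w)+\mu(z,[\![x,y,w]\!])=[D(x,y),\mu(z,w)],$$ $$\mu(z,w)\mu(x,y)-\mu(y,w)\mu(x,z)-\mu(x,[\![y,z,w]\!])+D(y,z)\mu(x,w)=0.$$ An action of $\mathfrak g$ on a Lie–Yamaguti algebra $\mathfrak h$ is a representation $(\mathfrak h;\rho,\mu)$ such that all $\rho(x)$ and $\mu(x,y)$ take values in $C(\mathfrak h)$ and vanish on all $[u,v]_{\mathfrak h}$ and $[\![u,v,w]\!]_{\mathfrak h}$. A crossed homomorphism with respect to the action is a linear map $H:\mathfrak g\to\mathfrak h$ with $$H[x,y]=\rho(x)Hy-\rho(y)Hx+[Hx,Hy],\qquad H[\![x,y,z]\!]=D(x,y)Hz+\mu(y,z)Hx-\mu(x,z)Hy+[\![Hx,Hy,Hz]\!].$$ Then $\mathfrak h$ is a representation of $\mathfrak g$ via $\rho_H(x)u=[Hx,u]+\rho(x)u$, $\mu_H(x,y)u=[\![u,Hx,Hy]\!]+\mu(x,y)u$; write $D_H=D_{\rho_H,\mu_H}$. Let $\mathfrak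 C^0_H(\mathfrak g,\mathfrak h)=\wedge^2\mathfrak g$, $\mathfrak C^1_H(\mathfrak g,\mathfrak h)=\mathrm{Hom}(\mathfrak g,\mathfrak h)$, and, for $n\ge1$, $\mathfrak C^{n+1}_H(\mathfrak g,\mathfrak h)=\mathrm{Hom}((\wedge^2\mathfrak g)^{\otimes n},\mathfrak h)\times\mathrm{Hom}((\wedge^2\mathfrak g)^{\otimes n}\otimes\mathfrak g,\mathfrak h)$. In degree $0$ let $\partial(x\wedge y)(z)=\mu(y,z)Hx-\mu(x,z)Hy+[\![Hx,Hy,Hz]\!]$. In degrees $\ge 1$ let $\partial=\delta^H$ be the Yamaguti coboundary with coefficients in $(\mathfrak h;\rho_H,\mu_H)$: for $f\in\mathfrak C^1_H$, $\delta^H f=(\delta_{\rm I}f,\delta_{\rm II}f)$ with $$\delta_{\rm I}f(x,y)=\rho_H(x)f(y)-\rho_H(y)f(x)-f([x,y]),\quad \delta_{\rm II}f(x,y,z)=D_H(x,y)f(z)+\mu_H(y,z)f(x)-\mu_H(x,z)f(y)-f([\![x,y,z]\!]),$$ and for $(f,g)\in\mathfrak C^{n+1}_H$, $n\ge1$, $\delta^H(f,g)=(\delta_{\rm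 I}(f,g),\delta_{\rm II}(f,g))$ where, with $\mathfrak X_i=x_i\wedge y_i$ and $\mathfrak X_k\circ\mathfrak X_l=[\![x_k,y_k,x_l]\!]\wedge y_l+x_l\wedge[\![x_k,y_k,y_l]\!]$, $$\begin{aligned}\delta_{\rm I}(f,g)(\mathfrak X_1,\dots,\mathfrak X_{n+1})={}&(-1)^n\big(\rho_H(x_{n+1})g(\mathfrak X_1,\dots,\mathfrak X_n,y_{n+1})-\rho_H(y_{n+1})g(\mathfrak X_1,\dots,\mathfrak X_n,x_{n+1})-g(\mathfrak X_1,\dots,\mathfrak X_n,[x_{n+1},y_{n+1}])\big)\\&+\sum_{k=1}^n(-1)^{k+1}D_H(\mathfrak X_k)f(\dots,\widehat{\mathfrak X_k},\dots)+\sum_{k<l\le n+1}(-1)^kf(\dots,\widehat{\mathfrak X_k},\dots,\mathfrak X_k\circ\mathfrak X_l,\dots),\\ \delta_{\rm II}(f,g)(\mathfrak X_1,\dots,\mathfrak X_{n+1},z)={}&(-1)^n\big(\mu_H(y_{n+1},z)g(\mathfrak X_1,\dots,\mathfrak X_n,x_{n+1})-\mu_H(x_{n+1},z)g(\mathfrak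 X_1,\dots,\mathfrak X_n,y_{n+1})\big)\\&+\sum_{k=1}^{n+1}(-1)^{k+1}D_H(\mathfrak X_k)g(\dots,\widehat{\mathfrak X_k},\dots,z)+\sum_{k<l\le n+1}(-1)^kg(\dots,\widehat{\mathfrak X_k},\dots,\mathfrak X_k\circ\mathfrak X_l,\dots,z)\\&+\sum_{k=1}^{n+1}(-1)^kg(\dots,\widehat{\mathfrak X_k},\dots,[\![x_k,y_k,z]\!]).\end{aligned}$$ Let $\mathcal H^n_H(\mathfrak g,\mathfrak h)$ be the space of $n$-cocycles modulo $n$-coboundaries of $(\bigoplus_{n\ge0}\mathfrak C^n_H(\mathfrak g,\mathfrak h),\partial)$. **Theorem.** Let $H,H':\mathfrak g\to\mathfrak h$ be crossed homomorphisms with respect to the same action $(\rho,\mu)$, and let $(\psi_{\mathfrak g},\psi_{\mathfrak h})$ be a homomorphism from $H'$ to $H$, i.e. $\psi_{\mathfrak g}:\mathfrak g\to\mathfrak g$ and $\psi_{\mathfrak h}:\mathfrak h\to\mathfrak h$ are Lie–Yamaguti algebra homomorphisms with $\psi_{\mathfrak h}\circ H'=H\circ\psi_{\mathfrak g}$, $\psi_{\mathfrak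 h}(\rho(x)u)=\rho(\psi_{\mathfrak g}x)\psi_{\mathfrak h}(u)$ and $\psi_{\mathfrak h}(\mu(x,y)u)=\mu(\psi_{\mathfrak g}x,\psi_{\mathfrak g}y)\psi_{\mathfrak h}(u)$. Assume that $\psi_{\mathfrak g}$ is invertible. For $n\ge1$ let $p:\mathfrak C^n_{H'}(\mathfrak g,\mathfrak h)\to\mathfrak C^n_H(\mathfrak g,\mathfrak h)$ be the map which sends $f$ (for $n=1$), respectively each of the two components of $(f,g)$ (for $n\ge2$), to its composite with $\psi_{\mathfrak g}^{-1}$ in all arguments (where $\psi_{\mathfrak g}^{-1}(x\wedge y)=\psi_{\mathfrak g}^{-1}x\wedge\psi_{\mathfrak g}^{-1}y$) followed by $\psi_{\mathfrak h}$. Then $p$ is a cochain map from $(\bigoplus_{n\ge1}\mathfrak C^n_{H'}(\mathfrak g,\mathfrak h),\delta^{H'})$ to $(\bigoplus_{n\ge1}\mathfrak C^n_H(\mathfrak g,\mathfrak h),\delta^H)$, i.e. $\delta^H\circ p=p\circ\delta^{H'}$ in every degree $n\ge1$. Consequently, for every $n\ge1$, $p$ maps $n$-cocycles of $H'$ to $n$-cocycles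 of $H$, and there is a unique linear map $p_*:\mathcal H^n_{H'}(\mathfrak g,\mathfrak h)\to\mathcal H^n_H(\mathfrak g,\mathfrak h)$ with $p_*[c]=[p(c)]$ for all cocycles $c$. -/

import Mathlib

universe u

noncomputable section

/-! ## Lie-Yamaguti algebras -/

/-- A Lie-Yamaguti algebra structure on a vector space `L`: a bilinear bracket `br x y = [x,y]` and
a trilinear bracket `tr x y z = ⟦x,y,z⟧`, alternating in `x, y`, with the four usual identities. -/
structure LieYamaguti (K L : Type*) [Field K] [AddCommGroup L] [Module K L] where
  br : L →ₗ[K] L →ₗ[K] L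
  tr : L →ₗ[K] L →ₗ[K] L →ₗ[K] L
  br_self : ∀ x, br x x = 0
  tr_self : ∀ x z, tr x x z = 0
  jacobi : ∀ x y z, br (br x y) z + br (br y z) x + br (br z x) y
    + tr x y z + tr y z x + tr z x y = 0
  tr_br_cyclic : ∀ x y z w, tr (br x y) z w + tr (br y z) x w + tr (br z x) y w = 0
  tr_br : ∀ x y z w, tr x y (br z w) = br (tr x y z) w + br z (tr x y w)
  tr_tr : ∀ x y z w t,
    tr x y (tr z w t) = tr (tr x y z) w t + tr z (tr x y w) t + tr z w (tr x y t)

namespace LieYamaguti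

variable {K L M V : Type*} [Field K] [AddCommGroup L] [Module K L]
  [AddCommGroup M] [Module K M] [AddCommGroup V] [Module K V]

/-- `φ` is a homomorphism of Lie-Yamaguti algebras. -/
def IsHom (G : LieYamaguti K L) (A : LieYamaguti K M) (φ : L →ₗ[K] M) : Prop :=
  (∀ x y, φ (G.br x y) = A.br (φ x) (φ y)) ∧
    ∀ x y z, φ (G.tr x y z) = A.tr (φ x) (φ y) (φ z)

/-- The center of a Lie-Yamaguti algebra. -/
def center (G : LieYamaguti K L) : Set L :=
  {x | ∀ y, G.br x y = 0} ∩ ({x | ∀ y z, G.tr x y z = 0} ∪ {x | ∀ y z, G.tr y x z = 0})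

/-- The bilinear map
`D_{ρ,μ}(x,y) = μ(y,x) - μ(x,y) + [ρ(x), ρ(y)] - ρ([x,y])` attached to `ρ : L → gl(V)` and
`μ : L ⊗ L → gl(V)`. -/
def Dop (G : LieYamaguti K L) (ρ : L →ₗ[K] Module.End K V) (μ : L →ₗ[K] L →ₗ[K] Module.End K V) :
    L →ₗ[K] L →ₗ[K] Module.End K V :=
  LinearMap.mk₂ K (fun x y => μ y x - μ x y + (ρ x * ρ y - ρ y * ρ x) - ρ (G.br x y))
    (by intros; simp only [map_add, LinearMap.add_apply, add_mul, mul_add]; abel)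
    (by intros; simp only [map_smul, LinearMap.smul_apply, smul_mul_assoc, mul_smul_comm]; module)
    (by intros; simp only [map_add, LinearMap.add_apply, add_mul, mul_add]; abel)
    (by intros; simp only [map_smul, LinearMap.smul_apply, smul_mul_assoc, mul_smul_comm]; module)

theorem Dop_apply (G : LieYamaguti K L) (ρ : L →ₗ[K] Module.End K V)
    (μ : L →ₗ[K] L →ₗ[K] Module.End K V) (x y : L) :
    G.Dop ρ μ x y = μ y x - μ x y + (ρ x * ρ y - ρ y * ρ x) - ρ (G.br x y) := rfl

theorem Dop_self (G : LieYamaguti K L) (ρ : L →ₗ[K] Module.End K V)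
    (μ : L →ₗ[K] L →ₗ[K] Module.End K V) (x : L) : G.Dop ρ μ x x = 0 := by
  simp [Dop_apply, G.br_self]

theorem br_swap (G : LieYamaguti K L) (x y : L) : G.br x y = -G.br y x := by
  have h := G.br_self (x + y)
  simp only [map_add, LinearMap.add_apply, G.br_self, zero_add, add_zero] at h
  exact eq_neg_of_add_eq_zero_right h

theorem tr_swap (G : LieYamaguti K L) (x y z : L) : G.tr x y z = -G.tr y x z := by
  have h := G.tr_self (x + y) z
  simp only [map_add, LinearMap.add_apply, G.tr_self, zero_add, add_zero] at h
  exact eq_neg_of_add_eq_zero_right h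

/-- Elements of the center annihilate both brackets in every slot. -/
theorem center_zero {G : LieYamaguti K L} {x : L} (hx : x ∈ G.center) :
    (∀ y, G.br x y = 0) ∧ (∀ y, G.br y x = 0) ∧ (∀ y z, G.tr x y z = 0) ∧
      (∀ y z, G.tr y x z = 0) ∧ ∀ y z, G.tr y z x = 0 := by
  obtain ⟨h1, h2⟩ := hx
  have h1 : ∀ y, G.br x y = 0 := h1
  have h1' : ∀ y, G.br y x = 0 := fun y => by rw [G.br_swap, h1, neg_zero]
  have h3 : (∀ y z, G.tr x y z = 0) ∧ ∀ y z, G.tr y x z = 0 := by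
    rcases h2 with h2 | h2
    · have h2 : ∀ y z, G.tr x y z = 0 := h2
      exact ⟨h2, fun y z => by rw [G.tr_swap, h2, neg_zero]⟩
    · have h2 : ∀ y z, G.tr y x z = 0 := h2
      exact ⟨fun y z => by rw [G.tr_swap, h2, neg_zero], h2⟩
  refine ⟨h1, h1', h3.1, h3.2, fun y z => ?_⟩
  have := G.jacobi x y z
  simpa [h1, h1', h3.1, h3.2] using this

end LieYamaguti

/-- A representation `(V; ρ, μ)` of a Lie-Yamaguti algebra. -/
structure LYRep {K L : Type*} [Field K] [AddCommGroup L] [Module K L] (G : LieYamaguti K L)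
    (V : Type*) [AddCommGroup V] [Module K V] where
  ρ : L →ₗ[K] Module.End K V
  μ : L →ₗ[K] L →ₗ[K] Module.End K V
  mu_br_left : ∀ x y z, μ (G.br x y) z - μ x z * ρ y + μ y z * ρ x = 0
  mu_br_right : ∀ x y z, μ x (G.br y z) - ρ y * μ x z + ρ z * μ x y = 0
  rho_tr : ∀ x y z, ρ (G.tr x y z) = G.Dop ρ μ x y * ρ z - ρ z * G.Dop ρ μ x y
  mu_mu : ∀ x y z w, μ z w * μ x y - μ y w * μ x z - μ x (G.tr y z w)
    + G.Dop ρ μ y z * μ x w = 0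
  mu_tr : ∀ x y z w, μ (G.tr x y z) w + μ z (G.tr x y w)
    = G.Dop ρ μ x y * μ z w - μ z w * G.Dop ρ μ x y

namespace LYRep

variable {K L V : Type*} [Field K] [AddCommGroup L] [Module K L] [AddCommGroup V] [Module K V]
  {G : LieYamaguti K L}

/-- The operator `D = D_{ρ,μ}` of a representation. -/
def D (R : LYRep G V) : L →ₗ[K] L →ₗ[K] Module.End K V := G.Dop R.ρ R.μ

end LYRep

/-- An action of a Lie-Yamaguti algebra `G` on a Lie-Yamaguti algebra `A`. -/
structure LYAction {K L M : Type*} [Field K] [AddCommGroup L] [Module K L] [AddCommGroup M]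
    [Module K M] (G : LieYamaguti K L) (A : LieYamaguti K M) extends LYRep G M where
  rho_mem : ∀ x u, ρ x u ∈ A.center
  mu_mem : ∀ x y u, μ x y u ∈ A.center
  rho_br : ∀ x u v, ρ x (A.br u v) = 0
  mu_br : ∀ x y u v, μ x y (A.br u v) = 0
  rho_tri : ∀ x u v w, ρ x (A.tr u v w) = 0
  mu_tri : ∀ x y u v w, μ x y (A.tr u v w) = 0

/-- A crossed homomorphism from `G` to `A` with respect to an action. -/
structure CrossedHom {K L M : Type*} [Field K] [AddCommGroup L] [Module K L] [AddCommGroup M]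
    [Module K M] {G : LieYamaguti K L} {A : LieYamaguti K M} (act : LYAction G A) where
  H : L →ₗ[K] M
  map_br : ∀ x y, H (G.br x y) = act.ρ x (H y) - act.ρ y (H x) + A.br (H x) (H y)
  map_tr : ∀ x y z, H (G.tr x y z) = act.D x y (H z) + act.μ y z (H x) - act.μ x z (H y)
    + A.tr (H x) (H y) (H z)

/-- A homomorphism `(ψ_𝔤, ψ_𝔥)` from a crossed homomorphism `H'` to a crossed homomorphism `H`. -/
structure CrossedHomMor {K L M : Type*} [Field K] [AddCommGroup L] [Module K L] [AddCommGroup M]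
    [Module K M] {G : LieYamaguti K L} {A : LieYamaguti K M} {act : LYAction G A}
    (H' H : CrossedHom act) where
  ψg : L →ₗ[K] L
  ψh : M →ₗ[K] M
  isHom_g : G.IsHom G ψg
  isHom_h : A.IsHom A ψh
  comm : ψh ∘ₗ H'.H = H.H ∘ₗ ψg
  map_rho : ∀ x u, ψh (act.ρ x u) = act.ρ (ψg x) (ψh u)
  map_mu : ∀ x y u, ψh (act.μ x y u) = act.μ (ψg x) (ψg y) (ψh u)

namespace CrossedHom

variable {K L M : Type*} [Field K] [AddCommGroup L] [Module K L] [AddCommGroup M]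
    [Module K M] {G : LieYamaguti K L} {A : LieYamaguti K M} {act : LYAction G A}

/-- `ρ_H(x)u = [Hx,u] + ρ(x)u`. -/
def rhoH (H : CrossedHom act) : L →ₗ[K] Module.End K M := A.br ∘ₗ H.H + act.ρ

/-- `μ_H(x,y)u = ⟦u,Hx,Hy⟧ + μ(x,y)u`. -/
def muH (H : CrossedHom act) : L →ₗ[K] L →ₗ[K] Module.End K M :=
  LinearMap.mk₂ K (fun x y => (A.tr.flip (H.H x)).flip (H.H y) + act.μ x y)
    (by intros; ext; simp; abel) (by intros; ext; simp)
    (by intros; ext; simp; abel) (by intros; ext; simp)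

theorem rhoH_apply (H : CrossedHom act) (x : L) (u : M) :
    H.rhoH x u = A.br (H.H x) u + act.ρ x u := rfl

theorem muH_apply (H : CrossedHom act) (x y : L) (u : M) :
    H.muH x y u = A.tr u (H.H x) (H.H y) + act.μ x y u := rfl

end CrossedHom

theorem LYAction.D_apply {K L M : Type*} [Field K] [AddCommGroup L] [Module K L] [AddCommGroup M]
    [Module K M] {G : LieYamaguti K L} {A : LieYamaguti K M} (act : LYAction G A) (x y : L)
    (u : M) : act.D x y u = act.μ y x u - act.μ x y u + (act.ρ x (act.ρ y u)
      - act.ρ y (act.ρ x u)) - act.ρ (G.br x y) u := rfl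

theorem LieYamaguti.mem_center {K L : Type*} [Field K] [AddCommGroup L] [Module K L]
    {G : LieYamaguti K L} {x : L} (h : ∀ y, G.br x y = 0) (h' : ∀ y z, G.tr x y z = 0) :
    x ∈ G.center := ⟨h, Or.inl h'⟩

namespace LYAction

variable {K L M : Type*} [Field K] [AddCommGroup L] [Module K L] [AddCommGroup M]
    [Module K M] {G : LieYamaguti K L} {A : LieYamaguti K M} (act : LYAction G A)

theorem D_mem (x y : L) (u : M) : act.D x y u ∈ A.center := by
  have hr := fun x u => LieYamaguti.center_zero (act.rho_mem x u)
  have hm := fun x y u => LieYamaguti.center_zero (act.mu_mem x y u)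
  apply LieYamaguti.mem_center <;> intros <;>
    simp [D_apply, (hr _ _).1, (hm _ _ _).1, (hr _ _).2.2.1, (hm _ _ _).2.2.1]

theorem D_br (x y : L) (u v : M) : act.D x y (A.br u v) = 0 := by
  simp [D_apply, act.rho_br, act.mu_br]

theorem D_tri (x y : L) (u v w : M) : act.D x y (A.tr u v w) = 0 := by
  simp [D_apply, act.rho_tri, act.mu_tri]

end LYAction

namespace CrossedHom

variable {K L M : Type*} [Field K] [AddCommGroup L] [Module K L] [AddCommGroup M]
    [Module K M] {G : LieYamaguti K L} {A : LieYamaguti K M} {act : LYAction G A}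

theorem Dop_H_apply (H : CrossedHom act) (x y : L) (u : M) :
    G.Dop H.rhoH H.muH x y u = A.tr (H.H x) (H.H y) u + act.D x y u := by
  have hr := fun x u => LieYamaguti.center_zero (act.rho_mem x u)
  have hJ := A.jacobi (H.H x) (H.H y) u
  have e1 := A.br_swap (H.H x) (A.br (H.H y) u)
  have e2 := A.br_swap (H.H y) (A.br (H.H x) u)
  have e3 : A.br (A.br u (H.H x)) (H.H y) = -A.br (A.br (H.H x) u) (H.H y) := by
    rw [A.br_swap u]; simp
  have e4 := A.tr_swap (H.H y) u (H.H x)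
  simp only [LieYamaguti.Dop_apply, LYAction.D_apply, LinearMap.sub_apply, LinearMap.add_apply,
    Module.End.mul_apply, rhoH_apply, muH_apply, map_add, map_sub, H.map_br, act.rho_br,
    (hr _ _).1, (hr _ _).2.1]
  rw [e1, e2]
  rw [e3, e4] at hJ
  rw [← sub_eq_zero, ← neg_eq_zero, ← hJ]
  abel

/-- The representation `(𝔥; ρ_H, μ_H)` of `𝔤` attached to a crossed homomorphism `H`. -/
def rep (H : CrossedHom act) : LYRep G M where
  ρ := H.rhoH
  μ := H.muH
  mu_br_left x y z := by
    ext u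
    have hr := fun x u => LieYamaguti.center_zero (act.rho_mem x u)
    have hm := fun x y u => LieYamaguti.center_zero (act.mu_mem x y u)
    have h0 := DFunLike.congr_fun (act.mu_br_left x y z) u
    have h1 := A.tr_br_cyclic (H.H x) (H.H y) u (H.H z)
    have h2 := A.tr_swap (A.br (H.H x) (H.H y)) u (H.H z)
    have h3 := A.br_swap u (H.H x)
    rw [h2, h3] at h1
    simp only [LinearMap.sub_apply, LinearMap.add_apply, LinearMap.zero_apply,
      Module.End.mul_apply, rhoH_apply, muH_apply, map_add, map_sub, H.map_br, act.mu_br,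
      (hr _ _).2.2.1, (hr _ _).2.2.2.1, map_neg, LinearMap.neg_apply] at h0 h1 ⊢
    rw [← h0, ← sub_eq_zero, ← neg_eq_zero, ← h1]
    abel
  mu_br_right x y z := by
    ext u
    have hr := fun x u => LieYamaguti.center_zero (act.rho_mem x u)
    have hm := fun x y u => LieYamaguti.center_zero (act.mu_mem x y u)
    have h0 := DFunLike.congr_fun (act.mu_br_right x y z) u
    have h1 := A.tr_br u (H.H x) (H.H y) (H.H z)
    have h2 := A.br_swap (A.tr u (H.H x) (H.H y)) (H.H z)
    simp only [LinearMap.sub_apply, LinearMap.add_apply, LinearMap.zero_apply,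
      Module.End.mul_apply, rhoH_apply, muH_apply, map_add, map_sub, H.map_br, act.rho_tri,
      (hr _ _).2.2.2.2, (hm _ _ _).2.1] at h0 h1 ⊢
    rw [h1, h2, ← h0]
    abel
  rho_tr x y z := by
    ext u
    have hr := fun x u => LieYamaguti.center_zero (act.rho_mem x u)
    have hm := fun x y u => LieYamaguti.center_zero (act.mu_mem x y u)
    have hD := fun x y u => LieYamaguti.center_zero (act.D_mem x y u)
    have h0 : act.ρ (G.tr x y z) u = act.D x y (act.ρ z u) - act.ρ z (act.D x y u) :=
      DFunLike.congr_fun (act.rho_tr x y z) u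
    have h1 := A.tr_br (H.H x) (H.H y) (H.H z) u
    simp only [LinearMap.sub_apply, LinearMap.add_apply,
      Module.End.mul_apply, rhoH_apply, Dop_H_apply, map_add, map_sub, H.map_tr,
      act.rho_tri, act.D_br, (hr _ _).2.2.2.2, (hm _ _ _).1, (hD _ _ _).1, (hD _ _ _).2.1]
    rw [h0, h1]
    abel
  mu_mu x y z w := by
    ext u
    have hm := fun x y u => LieYamaguti.center_zero (act.mu_mem x y u)
    have hD := fun x y u => LieYamaguti.center_zero (act.D_mem x y u)
    have h0 : act.μ z w (act.μ x y u) - act.μ y w (act.μ x z u) - act.μ x (G.tr y z w) u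
      + act.D y z (act.μ x w u) = 0 := DFunLike.congr_fun (act.mu_mu x y z w) u
    have h1 := A.tr_tr u (H.H x) (H.H y) (H.H z) (H.H w)
    have h2 := A.tr_swap (H.H y) (A.tr u (H.H x) (H.H z)) (H.H w)
    simp only [LinearMap.sub_apply, LinearMap.add_apply, LinearMap.zero_apply,
      Module.End.mul_apply, muH_apply, Dop_H_apply, map_add, map_sub, H.map_tr,
      act.mu_tri, act.D_tri, (hm _ _ _).2.2.1, (hm _ _ _).2.2.2.2, (hD _ _ _).2.2.2.2]
    rw [h1, h2]
    refine Eq.trans ?_ h0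
    abel
  mu_tr x y z w := by
    ext u
    have hm := fun x y u => LieYamaguti.center_zero (act.mu_mem x y u)
    have hD := fun x y u => LieYamaguti.center_zero (act.D_mem x y u)
    have h0 : act.μ (G.tr x y z) w u + act.μ z (G.tr x y w) u
      = act.D x y (act.μ z w u) - act.μ z w (act.D x y u) :=
      DFunLike.congr_fun (act.mu_tr x y z w) u
    have h1 := A.tr_tr (H.H x) (H.H y) u (H.H z) (H.H w)
    simp only [LinearMap.sub_apply, LinearMap.add_apply,
      Module.End.mul_apply, muH_apply, Dop_H_apply, map_add, map_sub, H.map_tr,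
      act.mu_tri, act.D_tri, (hm _ _ _).2.2.2.1, (hm _ _ _).2.2.2.2, (hD _ _ _).2.2.2.2,
      (hD _ _ _).2.2.2.1, (hD _ _ _).2.2.1]
    rw [h1]
    linear_combination (norm := module) h0

end CrossedHom

/-! ## The exterior square -/

section ExteriorSquare

variable {K L N : Type*} [Field K] [AddCommGroup L] [Module K L] [AddCommGroup N] [Module K N]

/-- The decomposable element `x ∧ y` of `⋀² L`. -/
def wedge (K : Type*) {L : Type*} [Field K] [AddCommGroup L] [Module K L] (x y : L) : ⋀[K]^2 L :=
  exteriorPower.ιMulti K 2 ![x, y]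

/-- The linear map `⋀² L → N`, `x ∧ y ↦ B x y`, attached to an alternating bilinear map `B`. -/
def wedgeLift (B : L →ₗ[K] L →ₗ[K] N) (hB : ∀ x, B x x = 0) : ⋀[K]^2 L →ₗ[K] N :=
  exteriorPower.alternatingMapLinearEquiv
    { toFun := fun v => B (v 0) (v 1)
      map_update_add' := by
        intro _ v i x y
        obtain rfl : ‹DecidableEq (Fin 2)› = instDecidableEqFin 2 := Subsingleton.elim _ _
        fin_cases i <;> simp
      map_update_smul' := by
        intro _ v i c x
        obtain rfl : ‹DecidableEq (Fin 2)› = instDecidableEqFin 2 := Subsingleton.elim _ _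
        fin_cases i <;> simp
      map_eq_zero_of_eq' := by
        intro v i j h hij
        fin_cases i <;> fin_cases j <;> simp_all }

theorem wedgeLift_wedge (B : L →ₗ[K] L →ₗ[K] N) (hB : ∀ x, B x x = 0) (x y : L) :
    wedgeLift B hB (wedge K x y) = B x y := by
  simp [wedgeLift, wedge, exteriorPower.alternatingMapLinearEquiv_apply_ιMulti]

theorem wedge_ext {f g : ⋀[K]^2 L →ₗ[K] N} (h : ∀ x y, f (wedge K x y) = g (wedge K x y)) :
    f = g := by
  refine exteriorPower.linearMap_ext (AlternatingMap.ext fun v => ?_)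
  have hv : v = ![v 0, v 1] := by ext i; fin_cases i <;> rfl
  have := h (v 0) (v 1)
  simp only [wedge] at this
  rw [hv]
  simpa using this

theorem upd0 {α : Type*} (x y z : α) : Function.update ![x, y] 0 z = ![z, y] := by
  ext i; fin_cases i <;> simp

theorem upd1 {α : Type*} (x y z : α) : Function.update ![x, y] 1 z = ![x, z] := by
  ext i; fin_cases i <;> simp

/-- The bilinear map `(x, y) ↦ x ∧ y`. -/
def wedgeBilin (K L : Type*) [Field K] [AddCommGroup L] [Module K L] :
    L →ₗ[K] L →ₗ[K] ⋀[K]^2 L :=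
  LinearMap.mk₂ K (fun x y => wedge K x y)
    (fun x x' y => by
      have h := (exteriorPower.ιMulti K 2 (M := L)).map_update_add ![x, y] 0 x x'
      rwa [upd0, upd0, upd0] at h)
    (fun c x y => by
      have h := (exteriorPower.ιMulti K 2 (M := L)).map_update_smul ![x, y] 0 c x
      rwa [upd0, upd0] at h)
    (fun x y y' => by
      have h := (exteriorPower.ιMulti K 2 (M := L)).map_update_add ![x, y] 1 y y'
      rwa [upd1, upd1, upd1] at h)
    (fun c x y => by
      have h := (exteriorPower.ιMulti K 2 (M := L)).map_update_smul ![x, y] 1 c y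
      rwa [upd1, upd1] at h)

theorem wedgeBilin_apply (x y : L) : wedgeBilin K L x y = wedge K x y := rfl

theorem wedge_self (x : L) : wedge K x x = 0 :=
  (exteriorPower.ιMulti K 2).map_eq_zero_of_eq ![x, x] (i := 0) (j := 1) rfl (by decide)

theorem wedge_swap (x y : L) : wedge K x y = -wedge K y x := by
  have h := wedge_self (K := K) (x + y)
  rw [← wedgeBilin_apply] at h
  simp only [map_add, LinearMap.add_apply, wedgeBilin_apply, wedge_self, zero_add, add_zero] at h
  exact eq_neg_of_add_eq_zero_right h

end ExteriorSquare

namespace LieYamaguti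

variable {K L : Type*} [Field K] [AddCommGroup L] [Module K L]

/-- `x ∧ y ↦ ⟦x, y, ·⟧`. -/
def trW (G : LieYamaguti K L) : ⋀[K]^2 L →ₗ[K] Module.End K L :=
  wedgeLift G.tr (fun x => LinearMap.ext (G.tr_self x))

theorem trW_wedge (G : LieYamaguti K L) (x y z : L) : G.trW (wedge K x y) z = G.tr x y z := by
  rw [trW, wedgeLift_wedge]

/-- The operation `𝔛 ∘ 𝔜` on `⋀² L`, given on decomposable elements by
`(x ∧ y) ∘ (z ∧ w) = ⟦x,y,z⟧ ∧ w + z ∧ ⟦x,y,w⟧` (see `circ_wedge`). -/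
def circ (G : LieYamaguti K L) : ⋀[K]^2 L →ₗ[K] ⋀[K]^2 L →ₗ[K] ⋀[K]^2 L where
  toFun X := wedgeLift (wedgeBilin K L ∘ₗ G.trW X + (wedgeBilin K L).compl₂ (G.trW X))
    (fun x => by
      simp only [LinearMap.add_apply, LinearMap.comp_apply, LinearMap.compl₂_apply,
        wedgeBilin_apply]
      rw [wedge_swap x, add_neg_cancel])
  map_add' X Y := wedge_ext fun x y => by
    simp only [LinearMap.add_apply, wedgeLift_wedge, map_add, LinearMap.comp_apply,
      LinearMap.compl₂_apply]
    abel
  map_smul' c X := wedge_ext fun x y => by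
    simp only [LinearMap.add_apply, LinearMap.smul_apply, wedgeLift_wedge, map_smul,
      LinearMap.comp_apply, LinearMap.compl₂_apply, RingHom.id_apply, smul_add]

theorem circ_wedge (G : LieYamaguti K L) (x y z w : L) :
    G.circ (wedge K x y) (wedge K z w)
      = wedge K (G.tr x y z) w + wedge K z (G.tr x y w) := by
  simp [circ, wedgeLift_wedge, wedgeBilin_apply, trW_wedge]

end LieYamaguti

/-! ## Multilinear maps on `⋀² L` -/

section Multilinear

variable {K P W W' : Type*} [Field K] [AddCommGroup P] [Module K P]
  [AddCommGroup W] [Module K W] [AddCommGroup W'] [Module K W']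

/-- The `(n+1)`-linear map `(X_0, …, X_n) ↦ B(X_k) (f(X_0, …, X̂_k, …, X_n))`. -/
def insertOp {n : ℕ} (k : Fin (n + 1)) (B : P →ₗ[K] W →ₗ[K] W')
    (f : MultilinearMap K (fun _ : Fin n => P) W) :
    MultilinearMap K (fun _ : Fin (n + 1) => P) W' :=
  LinearMap.uncurryMid k
    { toFun := fun X => (B X).compMultilinearMap f
      map_add' := fun X Y => by ext; simp
      map_smul' := fun c X => by ext; simp }

theorem insertOp_apply {n : ℕ} (k : Fin (n + 1)) (B : P →ₗ[K] W →ₗ[K] W')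
    (f : MultilinearMap K (fun _ : Fin n => P) W) (X : Fin (n + 1) → P) :
    insertOp k B f X = B (X k) (f (k.removeNth X)) := rfl

/-- The `(n+1)`-linear map `(X_0, …, X_n) ↦ f(X_0, …, X̂_k, …, c(X_k)(X_l), …, X_n)`, where the
position `l ≠ k` is `l = k.succAbove j`. -/
def insertCirc {n : ℕ} (k : Fin (n + 1)) (j : Fin n) (c : P →ₗ[K] P →ₗ[K] P)
    (f : MultilinearMap K (fun _ : Fin n => P) W) :
    MultilinearMap K (fun _ : Fin (n + 1) => P) W :=
  LinearMap.uncurryMid k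
    { toFun := fun X => f.compLinearMap (Function.update (fun _ => LinearMap.id) j (c X))
      map_add' := fun X Y => by
        have h := (MultilinearMap.compLinearMapMultilinear (R := K) (M₁ := fun _ : Fin n => P)
          (M₁' := fun _ : Fin n => P) (M₂ := W)).map_update_add
            (fun _ => LinearMap.id) j (c X) (c Y)
        rw [map_add]
        exact LinearMap.congr_fun h f
      map_smul' := fun a X => by
        have h := (MultilinearMap.compLinearMapMultilinear (R := K) (M₁ := fun _ : Fin n => P)
          (M₁' := fun _ : Fin n => P) (M₂ := W)).map_update_smul
            (fun _ => LinearMap.id) j a (c X)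
        rw [map_smul]
        exact LinearMap.congr_fun h f }

theorem insertCirc_apply {n : ℕ} (k : Fin (n + 1)) (j : Fin n) (c : P →ₗ[K] P →ₗ[K] P)
    (f : MultilinearMap K (fun _ : Fin n => P) W) (X : Fin (n + 1) → P) :
    insertCirc k j c f X = f (k.removeNth
      (Function.update X (k.succAbove j) (c (X k) (X (k.succAbove j))))) := by
  rw [Fin.removeNth_update_succAbove]
  change f (fun i => (Function.update (fun _ => LinearMap.id) j (c (X k)) : Fin n → P →ₗ[K] P) i
    (k.removeNth X i)) = _
  congr 1
  ext i
  by_cases h : i = j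
  · subst h; simp [Fin.removeNth]
  · simp [h]

/-- The sum `∑_{k<l} (-1)^{k+1} f(X_0, …, X̂_k, …, c(X_k)(X_l), …, X_n)`, indices from `0`. -/
def circSum {n : ℕ} (c : P →ₗ[K] P →ₗ[K] P) (f : MultilinearMap K (fun _ : Fin n => P) W) :
    MultilinearMap K (fun _ : Fin (n + 1) => P) W :=
  ∑ k : Fin (n + 1), ∑ j : Fin n,
    if k < k.succAbove j then (-1 : K) ^ ((k : ℕ) + 1) • insertCirc k j c f else 0

theorem circSum_apply {n : ℕ} (c : P →ₗ[K] P →ₗ[K] P)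
    (f : MultilinearMap K (fun _ : Fin n => P) W) (X : Fin (n + 1) → P) :
    circSum c f X = ∑ k : Fin (n + 1), ∑ l : Fin (n + 1), if k < l then
      (-1 : K) ^ ((k : ℕ) + 1) • f (k.removeNth (Function.update X l (c (X k) (X l)))) else 0 := by
  simp only [circSum, sum_apply]
  refine Finset.sum_congr rfl fun k _ => ?_
  rw [Fin.sum_univ_succAbove _ k]
  simp only [lt_irrefl, if_false, zero_add]
  refine Finset.sum_congr rfl fun j _ => ?_
  split_ifs
  · rw [smul_apply, insertCirc_apply]
  · rfl

theorem insertOp_add {n : ℕ} (k : Fin (n + 1)) (B : P →ₗ[K] W →ₗ[K] W')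
    (f f' : MultilinearMap K (fun _ : Fin n => P) W) :
    insertOp k B (f + f') = insertOp k B f + insertOp k B f' :=
  MultilinearMap.ext fun X => map_add (B (X k)) _ _

theorem insertOp_smul {n : ℕ} (k : Fin (n + 1)) (B : P →ₗ[K] W →ₗ[K] W') (a : K)
    (f : MultilinearMap K (fun _ : Fin n => P) W) :
    insertOp k B (a • f) = a • insertOp k B f :=
  MultilinearMap.ext fun X => map_smul (B (X k)) a _

theorem circSum_add {n : ℕ} (c : P →ₗ[K] P →ₗ[K] P)
    (f f' : MultilinearMap K (fun _ : Fin n => P) W) :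
    circSum c (f + f') = circSum c f + circSum c f' := by
  ext X
  simp only [circSum_apply, add_apply, smul_add, ← Finset.sum_add_distrib]
  refine Finset.sum_congr rfl fun k _ => Finset.sum_congr rfl fun l _ => ?_
  split_ifs <;> simp

theorem circSum_smul {n : ℕ} (c : P →ₗ[K] P →ₗ[K] P) (a : K)
    (f : MultilinearMap K (fun _ : Fin n => P) W) :
    circSum c (a • f) = a • circSum c f := by
  ext X
  simp only [circSum_apply, smul_apply, Finset.smul_sum]
  refine Finset.sum_congr rfl fun k _ => Finset.sum_congr rfl fun l _ => ?_
  split_ifs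
  · rw [smul_comm]
  · rw [smul_zero]

end Multilinear

/-! ## The Yamaguti complex -/

/-- The space `Hom(⋀² L ⊗ ⋯ ⊗ ⋀² L, W)`, with `n` tensor factors. -/
abbrev WedgeHom (K L W : Type*) [Field K] [AddCommGroup L] [Module K L] [AddCommGroup W]
    [Module K W] (n : ℕ) := MultilinearMap K (fun _ : Fin n => ⋀[K]^2 L) W

namespace LYRep

variable {K L V : Type*} [Field K] [AddCommGroup L] [Module K L] [AddCommGroup V] [Module K V]
  {G : LieYamaguti K L}

/-- `x ∧ y ↦ D(x, y)`. -/
def DW (R : LYRep G V) : ⋀[K]^2 L →ₗ[K] Module.End K V := wedgeLift R.D (G.Dop_self R.ρ R.μ)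

theorem DW_wedge (R : LYRep G V) (x y : L) : R.DW (wedge K x y) = R.D x y := wedgeLift_wedge _ _ _ _

/-- `x ∧ y ↦ (φ ↦ ρ(x)φ(y) - ρ(y)φ(x) - φ([x,y]))`, for `φ : L → V`. -/
def opI (R : LYRep G V) : ⋀[K]^2 L →ₗ[K] (L →ₗ[K] V) →ₗ[K] V :=
  wedgeLift
    (LinearMap.mk₂ K (fun x y =>
        R.ρ x ∘ₗ LinearMap.applyₗ y - R.ρ y ∘ₗ LinearMap.applyₗ x - LinearMap.applyₗ (G.br x y))
      (by intros; ext; simp; abel) (by intros; ext; simp [smul_sub])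
      (by intros; ext; simp; abel) (by intros; ext; simp [smul_sub]))
    (fun x => by ext; simp [G.br_self])

theorem opI_wedge (R : LYRep G V) (x y : L) (φ : L →ₗ[K] V) :
    R.opI (wedge K x y) φ = R.ρ x (φ y) - R.ρ y (φ x) - φ (G.br x y) := by
  rw [opI, wedgeLift_wedge]; rfl

/-- `x ∧ y ↦ (φ ↦ (z ↦ μ(y,z)φ(x) - μ(x,z)φ(y)))`, for `φ : L → V`. -/
def opII (R : LYRep G V) : ⋀[K]^2 L →ₗ[K] (L →ₗ[K] V) →ₗ[K] (L →ₗ[K] V) :=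
  wedgeLift
    (LinearMap.mk₂ K (fun x y =>
        (LinearMap.mk₂ K (fun (φ : L →ₗ[K] V) z => R.μ y z (φ x) - R.μ x z (φ y))
          (by intros; simp; abel) (by intros; simp [smul_sub])
          (by intros; simp; abel) (by intros; simp [smul_sub]) :
          (L →ₗ[K] V) →ₗ[K] L →ₗ[K] V))
      (by intros; ext; simp; abel) (by intros; ext; simp [smul_sub])
      (by intros; ext; simp; abel) (by intros; ext; simp [smul_sub]))
    (fun x => by ext; simp)

theorem opII_wedge (R : LYRep G V) (x y : L) (φ : L →ₗ[K] V) (z : L) :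
    R.opII (wedge K x y) φ z = R.μ y z (φ x) - R.μ x z (φ y) := by
  rw [opII, wedgeLift_wedge]; rfl

/-- `X ↦ (φ ↦ D(X) ∘ φ)`, for `φ : L → V`. -/
def opD (R : LYRep G V) : ⋀[K]^2 L →ₗ[K] (L →ₗ[K] V) →ₗ[K] (L →ₗ[K] V) :=
  LinearMap.mk₂ K (fun X φ => R.DW X ∘ₗ φ)
    (by intros; ext; simp) (by intros; ext; simp) (by intros; ext; simp) (by intros; ext; simp)

/-- `X ↦ (φ ↦ φ ∘ ⟦X, ·⟧)`, for `φ : L → V`. -/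
def opT (_R : LYRep G V) : ⋀[K]^2 L →ₗ[K] (L →ₗ[K] V) →ₗ[K] (L →ₗ[K] V) :=
  LinearMap.mk₂ K (fun X φ => φ ∘ₗ G.trW X)
    (by intros; ext; simp) (by intros; ext; simp) (by intros; ext; simp) (by intros; ext; simp)

/-- The first component `δ_I(f,g)` of the coboundary; see `deltaI_apply` for the formula. -/
def deltaI (R : LYRep G V) {n : ℕ} (f : WedgeHom K L V n) (g : WedgeHom K L (L →ₗ[K] V) n) :
    WedgeHom K L V (n + 1) :=
  (-1 : K) ^ n • insertOp (Fin.last n) R.opI g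
    + ∑ k : Fin n, (-1 : K) ^ (k : ℕ) • insertOp k.castSucc R.DW f
    + circSum G.circ f

/-- The second component `δ_II(f,g)` of the coboundary; see `deltaII_apply` for the formula. -/
def deltaII (R : LYRep G V) {n : ℕ} (g : WedgeHom K L (L →ₗ[K] V) n) :
    WedgeHom K L (L →ₗ[K] V) (n + 1) :=
  (-1 : K) ^ n • insertOp (Fin.last n) R.opII g
    + ∑ k : Fin (n + 1), (-1 : K) ^ (k : ℕ) • insertOp k R.opD g
    + circSum G.circ g
    + ∑ k : Fin (n + 1), (-1 : K) ^ ((k : ℕ) + 1) • insertOp k R.opT g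

/-- The coboundary formula for `δ_I(f,g)` at `X_i = x_i ∧ y_i`. Indices start from `0`. -/
theorem deltaI_apply (R : LYRep G V) {n : ℕ} (f : WedgeHom K L V n)
    (g : WedgeHom K L (L →ₗ[K] V) n) (x y : Fin (n + 1) → L) (X : Fin (n + 1) → ⋀[K]^2 L)
    (hX : ∀ i, X i = wedge K (x i) (y i)) :
    R.deltaI f g X =
      (-1 : K) ^ n • (R.ρ (x (Fin.last n)) (g (Fin.init X) (y (Fin.last n)))
          - R.ρ (y (Fin.last n)) (g (Fin.init X) (x (Fin.last n)))
          - g (Fin.init X) (G.br (x (Fin.last n)) (y (Fin.last n))))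
      + ∑ k : Fin n, (-1 : K) ^ (k : ℕ) •
          R.D (x k.castSucc) (y k.castSucc) (f (k.castSucc.removeNth X))
      + ∑ k : Fin (n + 1), ∑ l : Fin (n + 1), if k < l then (-1 : K) ^ ((k : ℕ) + 1) •
          f (k.removeNth (Function.update X l
            (wedge K (G.tr (x k) (y k) (x l)) (y l) + wedge K (x l) (G.tr (x k) (y k) (y l)))))
        else 0 := by
  simp only [deltaI, add_apply, smul_apply,
    sum_apply, insertOp_apply, circSum_apply, Fin.removeNth_last]
  congr 1
  · congr 1
    · rw [hX, opI_wedge]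
    · exact Finset.sum_congr rfl fun k _ => by rw [hX, DW_wedge]
  · refine Finset.sum_congr rfl fun k _ => Finset.sum_congr rfl fun l _ => ?_
    rw [hX k, hX l, LieYamaguti.circ_wedge]

/-- The coboundary formula for `δ_II(f,g)` at `X_i = x_i ∧ y_i`. Indices start from `0`. -/
theorem deltaII_apply (R : LYRep G V) {n : ℕ}
    (g : WedgeHom K L (L →ₗ[K] V) n) (x y : Fin (n + 1) → L) (X : Fin (n + 1) → ⋀[K]^2 L)
    (hX : ∀ i, X i = wedge K (x i) (y i)) (z : L) :
    R.deltaII g X z =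
      (-1 : K) ^ n • (R.μ (y (Fin.last n)) z (g (Fin.init X) (x (Fin.last n)))
          - R.μ (x (Fin.last n)) z (g (Fin.init X) (y (Fin.last n))))
      + ∑ k : Fin (n + 1), (-1 : K) ^ (k : ℕ) • R.D (x k) (y k) (g (k.removeNth X) z)
      + (∑ k : Fin (n + 1), ∑ l : Fin (n + 1), if k < l then (-1 : K) ^ ((k : ℕ) + 1) •
          g (k.removeNth (Function.update X l
            (wedge K (G.tr (x k) (y k) (x l)) (y l) + wedge K (x l) (G.tr (x k) (y k) (y l))))) z
        else 0)
      + ∑ k : Fin (n + 1), (-1 : K) ^ ((k : ℕ) + 1) •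
          g (k.removeNth X) (G.tr (x k) (y k) z) := by
  simp only [deltaII, add_apply, smul_apply,
    sum_apply, insertOp_apply, circSum_apply, Fin.removeNth_last,
    LinearMap.add_apply, LinearMap.smul_apply, LinearMap.sum_apply]
  congr 1
  · congr 1
    · congr 1
      · rw [hX, opII_wedge]
      · exact Finset.sum_congr rfl fun k _ => by rw [hX, ← DW_wedge]; rfl
    · refine Finset.sum_congr rfl fun k _ => Finset.sum_congr rfl fun l _ => ?_
      rw [hX k, hX l, LieYamaguti.circ_wedge]
      split_ifs <;> rfl
  · refine Finset.sum_congr rfl fun k _ => ?_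
    rw [hX k]
    change _ • (g (k.removeNth X)) (G.trW _ z) = _
    rw [LieYamaguti.trW_wedge]

theorem deltaI_add (R : LYRep G V) {n : ℕ} (f f' : WedgeHom K L V n)
    (g g' : WedgeHom K L (L →ₗ[K] V) n) :
    R.deltaI (f + f') (g + g') = R.deltaI f g + R.deltaI f' g' := by
  simp only [deltaI, insertOp_add, circSum_add, smul_add, Finset.sum_add_distrib]
  abel

theorem deltaI_smul (R : LYRep G V) {n : ℕ} (a : K) (f : WedgeHom K L V n)
    (g : WedgeHom K L (L →ₗ[K] V) n) : R.deltaI (a • f) (a • g) = a • R.deltaI f g := by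
  simp only [deltaI, insertOp_smul, circSum_smul, smul_add, Finset.smul_sum, smul_comm a]

theorem deltaII_add (R : LYRep G V) {n : ℕ} (g g' : WedgeHom K L (L →ₗ[K] V) n) :
    R.deltaII (g + g') = R.deltaII g + R.deltaII g' := by
  simp only [deltaII, insertOp_add, circSum_add, smul_add, Finset.sum_add_distrib]
  abel

theorem deltaII_smul (R : LYRep G V) {n : ℕ} (a : K) (g : WedgeHom K L (L →ₗ[K] V) n) :
    R.deltaII (a • g) = a • R.deltaII g := by
  simp only [deltaII, insertOp_smul, circSum_smul, smul_add, Finset.smul_sum, smul_comm a]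

/-- The first component of the coboundary of a `1`-cochain `φ`; see `deltaOneI_apply`. -/
def deltaOneI (R : LYRep G V) (φ : L →ₗ[K] V) : WedgeHom K L V 1 :=
  insertOp 0 R.opI (MultilinearMap.constOfIsEmpty K _ φ)

/-- The second component of the coboundary of a `1`-cochain `φ`; see `deltaOneII_apply`. -/
def deltaOneII (R : LYRep G V) (φ : L →ₗ[K] V) : WedgeHom K L (L →ₗ[K] V) 1 :=
  insertOp 0 (R.opD + R.opII - R.opT) (MultilinearMap.constOfIsEmpty K _ φ)

theorem deltaOneI_apply (R : LYRep G V) (φ : L →ₗ[K] V) (x y : L) :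
    R.deltaOneI φ ![wedge K x y] = R.ρ x (φ y) - R.ρ y (φ x) - φ (G.br x y) :=
  R.opI_wedge x y φ

theorem deltaOneII_apply (R : LYRep G V) (φ : L →ₗ[K] V) (x y z : L) :
    R.deltaOneII φ ![wedge K x y] z
      = R.D x y (φ z) + R.μ y z (φ x) - R.μ x z (φ y) - φ (G.tr x y z) := by
  change R.DW (wedge K x y) (φ z) + R.opII (wedge K x y) φ z - φ (G.trW (wedge K x y) z) = _
  rw [DW_wedge, opII_wedge, LieYamaguti.trW_wedge]
  abel

end LYRep

section Complex

variable {K L M : Type u} [Field K] [AddCommGroup L] [Module K L] [AddCommGroup M] [Module K M]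

/-- The cochain spaces of a crossed homomorphism `L → M`: `⋀² L` in degree `0`, `Hom(L, M)` in
degree `1`, and `Hom((⋀² L)^{⊗ m}, M) × Hom((⋀² L)^{⊗ m} ⊗ L, M)` in degree `m + 1`, `m ≥ 1`
(the second factor is written in curried form). -/
def Cochain (K L M : Type u) [Field K] [AddCommGroup L] [Module K L] [AddCommGroup M]
    [Module K M] : ℕ → Type u
  | 0 => ⋀[K]^2 L
  | 1 => L →ₗ[K] M
  | n + 2 => WedgeHom K L M (n + 1) × WedgeHom K L (L →ₗ[K] M) (n + 1)

instance Cochain.instAddCommGroup : ∀ n, AddCommGroup (Cochain K L M n)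
  | 0 => inferInstanceAs (AddCommGroup (⋀[K]^2 L))
  | 1 => inferInstanceAs (AddCommGroup (L →ₗ[K] M))
  | n + 2 => inferInstanceAs
      (AddCommGroup (WedgeHom K L M (n + 1) × WedgeHom K L (L →ₗ[K] M) (n + 1)))

instance Cochain.instModule : ∀ n, Module K (Cochain K L M n)
  | 0 => inferInstanceAs (Module K (⋀[K]^2 L))
  | 1 => inferInstanceAs (Module K (L →ₗ[K] M))
  | n + 2 => inferInstanceAs
      (Module K (WedgeHom K L M (n + 1) × WedgeHom K L (L →ₗ[K] M) (n + 1)))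

/-- The Yamaguti coboundary `C^{n+1} → C^{n+2}` with coefficients in a representation. -/
def LYRep.coboundary {G : LieYamaguti K L} (R : LYRep G M) :
    ∀ n, Cochain K L M (n + 1) →ₗ[K] Cochain K L M (n + 2)
  | 0 =>
    { toFun := fun φ : L →ₗ[K] M =>
        ((R.deltaOneI φ, R.deltaOneII φ) : WedgeHom K L M 1 × WedgeHom K L (L →ₗ[K] M) 1)
      map_add' := fun φ φ' => Prod.ext (MultilinearMap.ext fun X => map_add (R.opI (X 0)) φ φ')
        (MultilinearMap.ext fun X => map_add ((R.opD + R.opII - R.opT) (X 0)) φ φ')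
      map_smul' := fun c φ => Prod.ext (MultilinearMap.ext fun X => map_smul (R.opI (X 0)) c φ)
        (MultilinearMap.ext fun X => map_smul ((R.opD + R.opII - R.opT) (X 0)) c φ) }
  | n + 1 =>
    { toFun := fun c : WedgeHom K L M (n + 1) × WedgeHom K L (L →ₗ[K] M) (n + 1) =>
        ((R.deltaI c.1 c.2, R.deltaII c.2) :
          WedgeHom K L M (n + 2) × WedgeHom K L (L →ₗ[K] M) (n + 2))
      map_add' := fun c c' => Prod.ext
        (R.deltaI_add c.1 c'.1 c.2 c'.2) (R.deltaII_add c.2 c'.2)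
      map_smul' := fun a c => Prod.ext (R.deltaI_smul a c.1 c.2) (R.deltaII_smul a c.2) }

namespace CrossedHom

variable {G : LieYamaguti K L} {A : LieYamaguti K M} {act : LYAction G A}

/-- The map `⋀² L → Hom(L, M)` sending `x ∧ y` to
`z ↦ μ(y,z)(Hx) - μ(x,z)(Hy) + ⟦Hx,Hy,Hz⟧`. -/
def deltaZero (H : CrossedHom act) : ⋀[K]^2 L →ₗ[K] (L →ₗ[K] M) :=
  wedgeLift
    (LinearMap.mk₂ K (fun x y =>
        (act.μ y).flip (H.H x) - (act.μ x).flip (H.H y)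
          + A.tr (H.H x) (H.H y) ∘ₗ H.H)
      (by intros; ext; simp; abel) (by intros; ext; simp [smul_sub])
      (by intros; ext; simp; abel) (by intros; ext; simp [smul_sub]))
    (fun x => by ext; simp [A.tr_self])

theorem deltaZero_apply (H : CrossedHom act) (x y z : L) :
    H.deltaZero (wedge K x y) z
      = act.μ y z (H.H x) - act.μ x z (H.H y) + A.tr (H.H x) (H.H y) (H.H z) := by
  rw [deltaZero, wedgeLift_wedge]; rfl

/-- The coboundary `∂` of the cochain complex of a crossed homomorphism `H`: in positive degrees it
is the Yamaguti coboundary with coefficients in `(𝔥; ρ_H, μ_H)`. -/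
def coboundary (H : CrossedHom act) : ∀ n, Cochain K L M n →ₗ[K] Cochain K L M (n + 1)
  | 0 => H.deltaZero
  | n + 1 => H.rep.coboundary n

/-- The `n`-cocycles of `H`. -/
def cocycles (H : CrossedHom act) (n : ℕ) : Submodule K (Cochain K L M n) :=
  LinearMap.ker (H.coboundary n)

/-- The `n`-coboundaries of `H`. -/
def coboundaries (H : CrossedHom act) : ∀ n, Submodule K (Cochain K L M n)
  | 0 => ⊥
  | n + 1 => LinearMap.range (H.coboundary n)

/-- The `n`-th cohomology group of `H`: cocycles modulo coboundaries. -/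
abbrev Cohomology (H : CrossedHom act) (n : ℕ) : Type u :=
  H.cocycles n ⧸ (H.coboundaries n).submoduleOf (H.cocycles n)

end CrossedHom

/-- `φ ↦ ψ ∘ φ ∘ θ` on linear maps `L → M`. -/
def conjHom (θ : L →ₗ[K] L) (ψ : M →ₗ[K] M) : (L →ₗ[K] M) →ₗ[K] (L →ₗ[K] M) where
  toFun φ := ψ ∘ₗ φ ∘ₗ θ
  map_add' φ φ' := by ext; simp
  map_smul' a φ := by ext; simp

/-- Conjugation `f ↦ ψ ∘ f ∘ (θ, …, θ)` on cochains of degree `n + 1`, where `θ` acts on `⋀² L`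
by `x ∧ y ↦ θ x ∧ θ y`. -/
def Cochain.conj (θ : L →ₗ[K] L) (ψ : M →ₗ[K] M) :
    ∀ n, Cochain K L M (n + 1) →ₗ[K] Cochain K L M (n + 1)
  | 0 => conjHom θ ψ
  | n + 1 =>
    { toFun := fun c : WedgeHom K L M (n + 1) × WedgeHom K L (L →ₗ[K] M) (n + 1) =>
        ((ψ.compMultilinearMap (c.1.compLinearMap fun _ => exteriorPower.map 2 θ),
          (conjHom θ ψ).compMultilinearMap (c.2.compLinearMap fun _ => exteriorPower.map 2 θ)) :
          WedgeHom K L M (n + 1) × WedgeHom K L (L →ₗ[K] M) (n + 1))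
      map_add' := fun _ _ => Prod.ext (MultilinearMap.ext fun _ => map_add ψ _ _)
        (MultilinearMap.ext fun _ => map_add (conjHom θ ψ) _ _)
      map_smul' := fun a _ => Prod.ext (MultilinearMap.ext fun _ => map_smul ψ a _)
        (MultilinearMap.ext fun _ => map_smul (conjHom θ ψ) a _) }

theorem map_wedge (θ : L →ₗ[K] L) (x y : L) :
    exteriorPower.map 2 θ (wedge K x y) = wedge K (θ x) (θ y) := by
  rw [wedge, exteriorPower.map_apply_ιMulti, wedge]
  congr 1
  ext i; fin_cases i <;> rfl

/-- The map `p(f) = ψ_𝔥 ∘ f ∘ ψ_𝔤⁻¹` on cochains of degree `n + 1`. -/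
def CrossedHomMor.p {G : LieYamaguti K L} {A : LieYamaguti K M} {act : LYAction G A}
    {H' H : CrossedHom act} (ψ : CrossedHomMor H' H) (hψ : Function.Bijective ψ.ψg) (n : ℕ) :
    Cochain K L M (n + 1) →ₗ[K] Cochain K L M (n + 1) :=
  Cochain.conj (LinearEquiv.ofBijective ψ.ψg hψ).symm ψ.ψh n

end Complex

end

/-! Put `θ = ψ_𝔤⁻¹` and `ψ = ψ_𝔥`. The map `p` is conjugation by `θ` on arguments and `ψ` on values,
and the Yamaguti complex is natural in such pairs. All that naturality needs is that `θ` preserves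
both brackets and that `ψ` carries the operators of `(ρ_{H'}, μ_{H'})` at `θ`-images to those of
`(ρ_H, μ_H)`. This is `LYRep.Intertwines`, which mentions no crossed homomorphism. It holds here
because `ψ_𝔥 H' θ = H ψ_𝔤 θ = H` and `ψ_𝔥` respects the brackets of `𝔥` and the action
(`CrossedHomMor.intertwines`). The coboundary is a signed sum of two kinds of terms: an operator
applied to one argument and to the value of the cochain at the rest (`insertOp`), and the terms with
`𝔛_k ∘ 𝔛_l` (`circSum`). Conjugation is linear, so it suffices to move it past each kind. For the
first this reduces to intertwining of the operators `opI`, `opII`, `DW`, `opD`, `opT`; for the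
second, to `⋀²θ` preserving `∘`. Both are checked on decomposable elements `x ∧ y`. A cochain map in
positive degrees preserves cocycles, and it preserves coboundaries in degrees at least `2`. The
1-coboundaries come from `⋀²𝔤`, where `p` is not defined; there `⋀²ψ_𝔤` takes over
(`deltaZero_map`). Passage to the quotient is then formal. -/

/-! ### Conjugation of multilinear maps -/

section MultilinearConj

variable {K P W W' : Type*} [Field K] [AddCommGroup P] [Module K P]
  [AddCommGroup W] [Module K W] [AddCommGroup W'] [Module K W']

/-- `f ↦ T ∘ f ∘ (Θ, …, Θ)` on multilinear maps. -/
def multilinearConj (Θ : P →ₗ[K] P) (T : W →ₗ[K] W) {n : ℕ}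
    (f : MultilinearMap K (fun _ : Fin n => P) W) : MultilinearMap K (fun _ : Fin n => P) W :=
  T.compMultilinearMap (f.compLinearMap fun _ => Θ)

theorem multilinearConj_apply (Θ : P →ₗ[K] P) (T : W →ₗ[K] W) {n : ℕ}
    (f : MultilinearMap K (fun _ : Fin n => P) W) (X : Fin n → P) :
    multilinearConj Θ T f X = T (f fun i => Θ (X i)) := rfl

theorem multilinearConj_add (Θ : P →ₗ[K] P) (T : W →ₗ[K] W) {n : ℕ}
    (f f' : MultilinearMap K (fun _ : Fin n => P) W) :
    multilinearConj Θ T (f + f') = multilinearConj Θ T f + multilinearConj Θ T f' :=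
  MultilinearMap.ext fun _ => map_add T _ _

theorem multilinearConj_smul (Θ : P →ₗ[K] P) (T : W →ₗ[K] W) {n : ℕ} (a : K)
    (f : MultilinearMap K (fun _ : Fin n => P) W) :
    multilinearConj Θ T (a • f) = a • multilinearConj Θ T f :=
  MultilinearMap.ext fun _ => map_smul T _ _

theorem multilinearConj_sum (Θ : P →ₗ[K] P) (T : W →ₗ[K] W) {n : ℕ} {ι : Type*} (s : Finset ι)
    (f : ι → MultilinearMap K (fun _ : Fin n => P) W) :
    multilinearConj Θ T (∑ i ∈ s, f i) = ∑ i ∈ s, multilinearConj Θ T (f i) := by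
  ext X
  simp only [multilinearConj_apply, sum_apply, map_sum]

/-- Conjugation commutes with `insertOp` when it intertwines the inserted operators. -/
theorem insertOp_multilinearConj {Θ : P →ₗ[K] P} {T : W →ₗ[K] W} {T' : W' →ₗ[K] W'}
    {B B' : P →ₗ[K] W →ₗ[K] W'} (h : ∀ X w, T' (B' (Θ X) w) = B X (T w))
    {n : ℕ} (k : Fin (n + 1)) (f : MultilinearMap K (fun _ : Fin n => P) W) :
    insertOp k B (multilinearConj Θ T f) = multilinearConj Θ T' (insertOp k B' f) :=
  -- Dropping the `k`-th argument commutes definitionally with applying `Θ` in each slot, so the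
  -- hypothesis at a single point is the whole claim.
  MultilinearMap.ext fun _ => (h _ _).symm

/-- Conjugation commutes with `circSum` when `Θ` preserves the operation `c`. -/
theorem circSum_multilinearConj {Θ : P →ₗ[K] P} {c : P →ₗ[K] P →ₗ[K] P}
    (h : ∀ X Y, Θ (c X Y) = c (Θ X) (Θ Y)) (T : W →ₗ[K] W)
    {n : ℕ} (f : MultilinearMap K (fun _ : Fin n => P) W) :
    circSum c (multilinearConj Θ T f) = multilinearConj Θ T (circSum c f) := by
  ext X
  simp only [multilinearConj_apply, circSum_apply, map_sum]
  refine Finset.sum_congr rfl fun k _ => Finset.sum_congr rfl fun l _ => ?_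
  split_ifs
  · rw [map_smul]
    -- What remains is to compare the two argument tuples of `f`. They agree definitionally except
    -- in the slot holding `c (X k) (X l)`, the only place where `h` is needed.
    congr 3
    ext1 i
    simp only [Fin.removeNth_apply, Function.update_apply]
    split_ifs
    · rw [h]
    · rfl
  · rw [map_zero]

end MultilinearConj

/-! ### Naturality of the operators entering the coboundary -/

section Intertwining

variable {K L M : Type u} [Field K] [AddCommGroup L] [Module K L] [AddCommGroup M] [Module K M]

theorem conjHom_apply (θ : L →ₗ[K] L) (ψ : M →ₗ[K] M) (φ : L →ₗ[K] M) (z : L) :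
    conjHom θ ψ φ z = ψ (φ (θ z)) := rfl

/-- On decomposables the operation `∘` involves only the ternary bracket, which `θ` preserves. -/
theorem LieYamaguti.IsHom.map_circ {G : LieYamaguti K L} {θ : L →ₗ[K] L} (hθ : G.IsHom G θ)
    (X Y : ⋀[K]^2 L) :
    exteriorPower.map 2 θ (G.circ X Y)
      = G.circ (exteriorPower.map 2 θ X) (exteriorPower.map 2 θ Y) := by
  -- Stated as an equality of bilinear maps, the identity can be tested on decomposables in each
  -- variable by `wedge_ext`. The later lemmas about `⋀²` follow the same pattern.
  suffices h : G.circ.compr₂ (exteriorPower.map 2 θ)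
      = G.circ.compl₁₂ (exteriorPower.map 2 θ) (exteriorPower.map 2 θ) from
    LinearMap.congr_fun₂ h X Y
  refine wedge_ext fun x y => wedge_ext fun z w => ?_
  simp only [LinearMap.compr₂_apply, LinearMap.compl₁₂_apply, map_wedge, LieYamaguti.circ_wedge,
    map_add, hθ.2]

/-- `ψ : M → M` is a morphism from `θ^* R'` to `R`, for representations `R'`, `R` on `M`. -/
structure LYRep.Intertwines {G : LieYamaguti K L} (R' R : LYRep G M) (θ : L →ₗ[K] L)
    (ψ : M →ₗ[K] M) : Prop where
  isHom : G.IsHom G θ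
  map_rho : ∀ x u, ψ (R'.ρ (θ x) u) = R.ρ x (ψ u)
  map_mu : ∀ x y u, ψ (R'.μ (θ x) (θ y) u) = R.μ x y (ψ u)

namespace LYRep.Intertwines

variable {G : LieYamaguti K L} {R' R : LYRep G M} {θ : L →ₗ[K] L} {ψ : M →ₗ[K] M}

/-- `D` is a polynomial expression in `ρ`, `μ` and the binary bracket, so it inherits the
intertwining. The bracket `[θx, θy]` is first rewritten as `θ[x, y]`, which brings `ρ'([θx, θy])`
within reach of `map_rho`. -/
theorem map_D (h : R'.Intertwines R θ ψ) (x y : L) (u : M) :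
    ψ (R'.D (θ x) (θ y) u) = R.D x y (ψ u) := by
  simp only [LYRep.D, LieYamaguti.Dop_apply, LinearMap.sub_apply, LinearMap.add_apply,
    Module.End.mul_apply, map_sub, map_add, h.map_mu, h.map_rho, ← h.isHom.1]

theorem map_DW (h : R'.Intertwines R θ ψ) (X : ⋀[K]^2 L) (u : M) :
    ψ (R'.DW (exteriorPower.map 2 θ X) u) = R.DW X (ψ u) := by
  suffices e : (R'.DW.compl₁₂ (exteriorPower.map 2 θ) LinearMap.id).compr₂ ψ
      = R.DW.compl₁₂ LinearMap.id ψ from LinearMap.congr_fun₂ e X u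
  refine wedge_ext fun x y => LinearMap.ext fun u => ?_
  simp only [LinearMap.compr₂_apply, LinearMap.compl₁₂_apply, map_wedge, DW_wedge,
    LinearMap.id_apply, h.map_D]

theorem map_opI (h : R'.Intertwines R θ ψ) (X : ⋀[K]^2 L) (φ : L →ₗ[K] M) :
    ψ (R'.opI (exteriorPower.map 2 θ X) φ) = R.opI X (conjHom θ ψ φ) := by
  suffices e : (R'.opI.compl₁₂ (exteriorPower.map 2 θ) LinearMap.id).compr₂ ψ
      = R.opI.compl₁₂ LinearMap.id (conjHom θ ψ) from LinearMap.congr_fun₂ e X φ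
  refine wedge_ext fun x y => LinearMap.ext fun φ => ?_
  simp only [LinearMap.compr₂_apply, LinearMap.compl₁₂_apply, map_wedge, opI_wedge,
    LinearMap.id_apply, map_sub, h.map_rho, conjHom_apply, h.isHom.1]

/-- The values are again maps `L → M`, so they are conjugated by `conjHom θ ψ` rather than by `ψ`
alone. This puts `θ` on the free variable `z` as well, as `map_mu` requires in both slots of `μ`. -/
theorem map_opII (h : R'.Intertwines R θ ψ) (X : ⋀[K]^2 L) (φ : L →ₗ[K] M) :
    conjHom θ ψ (R'.opII (exteriorPower.map 2 θ X) φ) = R.opII X (conjHom θ ψ φ) := by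
  suffices e : (R'.opII.compl₁₂ (exteriorPower.map 2 θ) LinearMap.id).compr₂ (conjHom θ ψ)
      = R.opII.compl₁₂ LinearMap.id (conjHom θ ψ) from LinearMap.congr_fun₂ e X φ
  refine wedge_ext fun x y => LinearMap.ext fun φ => LinearMap.ext fun z => ?_
  simp only [LinearMap.compr₂_apply, LinearMap.compl₁₂_apply, map_wedge, opII_wedge,
    LinearMap.id_apply, map_sub, h.map_mu, conjHom_apply]

theorem map_opD (h : R'.Intertwines R θ ψ) (X : ⋀[K]^2 L) (φ : L →ₗ[K] M) :
    conjHom θ ψ (R'.opD (exteriorPower.map 2 θ X) φ) = R.opD X (conjHom θ ψ φ) :=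
  LinearMap.ext fun z => h.map_DW X (φ (θ z))

theorem map_trW (h : R'.Intertwines R θ ψ) (X : ⋀[K]^2 L) (z : L) :
    θ (G.trW X z) = G.trW (exteriorPower.map 2 θ X) (θ z) := by
  suffices e : G.trW.compr₂ θ = G.trW.compl₁₂ (exteriorPower.map 2 θ) θ from
    LinearMap.congr_fun₂ e X z
  refine wedge_ext fun x y => LinearMap.ext fun z => ?_
  simp only [LinearMap.compr₂_apply, LinearMap.compl₁₂_apply, map_wedge, LieYamaguti.trW_wedge,
    h.isHom.2]

/-- No representation operator occurs in this term, so only compatibility of `θ` with the ternary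
bracket matters. -/
theorem map_opT (h : R'.Intertwines R θ ψ) (X : ⋀[K]^2 L) (φ : L →ₗ[K] M) :
    conjHom θ ψ (R'.opT (exteriorPower.map 2 θ X) φ) = R.opT X (conjHom θ ψ φ) :=
  LinearMap.ext fun z => congrArg (fun t => ψ (φ t)) (h.map_trW X z).symm

/-! ### Naturality of the Yamaguti coboundary -/

theorem deltaOneI_conj (h : R'.Intertwines R θ ψ) (φ : L →ₗ[K] M) :
    R.deltaOneI (conjHom θ ψ φ)
      = multilinearConj (exteriorPower.map 2 θ) ψ (R'.deltaOneI φ) :=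
  MultilinearMap.ext fun _ => (h.map_opI _ φ).symm

theorem deltaOneII_conj (h : R'.Intertwines R θ ψ) (φ : L →ₗ[K] M) :
    R.deltaOneII (conjHom θ ψ φ)
      = multilinearConj (exteriorPower.map 2 θ) (conjHom θ ψ) (R'.deltaOneII φ) := by
  refine MultilinearMap.ext fun X => ?_
  change (R.opD + R.opII - R.opT) (X 0) (conjHom θ ψ φ)
    = conjHom θ ψ ((R'.opD + R'.opII - R'.opT) (exteriorPower.map 2 θ (X 0)) φ)
  simp only [LinearMap.sub_apply, LinearMap.add_apply, map_sub, map_add, h.map_opD, h.map_opII,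
    h.map_opT]

theorem deltaI_conj (h : R'.Intertwines R θ ψ) {n : ℕ} (f : WedgeHom K L M n)
    (g : WedgeHom K L (L →ₗ[K] M) n) :
    R.deltaI (multilinearConj (exteriorPower.map 2 θ) ψ f)
        (multilinearConj (exteriorPower.map 2 θ) (conjHom θ ψ) g)
      = multilinearConj (exteriorPower.map 2 θ) ψ (R'.deltaI f g) := by
  simp only [deltaI, insertOp_multilinearConj h.map_opI, insertOp_multilinearConj h.map_DW,
    circSum_multilinearConj h.isHom.map_circ, multilinearConj_add, multilinearConj_smul,
    multilinearConj_sum]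

/-- Since `g` is curried, `conjHom θ ψ` on its values accounts for the last argument in `𝔤`; the
terms then match one by one, as for `δ_I`. -/
theorem deltaII_conj (h : R'.Intertwines R θ ψ) {n : ℕ} (g : WedgeHom K L (L →ₗ[K] M) n) :
    R.deltaII (multilinearConj (exteriorPower.map 2 θ) (conjHom θ ψ) g)
      = multilinearConj (exteriorPower.map 2 θ) (conjHom θ ψ) (R'.deltaII g) := by
  simp only [deltaII, insertOp_multilinearConj h.map_opII, insertOp_multilinearConj h.map_opD,
    insertOp_multilinearConj h.map_opT, circSum_multilinearConj h.isHom.map_circ,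
    multilinearConj_add, multilinearConj_smul, multilinearConj_sum]

/-- Conjugation by intertwining maps commutes with the Yamaguti coboundary. -/
theorem coboundary_conj (h : R'.Intertwines R θ ψ) :
    ∀ n, R.coboundary n ∘ₗ Cochain.conj θ ψ n = Cochain.conj θ ψ (n + 1) ∘ₗ R'.coboundary n
  -- In both cases each component of `Cochain.conj` on pairs unfolds to `multilinearConj`. Degree
  -- `1` stands apart because its cochains are single maps and its coboundary has its own formula.
  | 0 => LinearMap.ext fun φ => Prod.ext (h.deltaOneI_conj φ) (h.deltaOneII_conj φ)
  | _ + 1 => LinearMap.ext fun c => Prod.ext (h.deltaI_conj c.1 c.2) (h.deltaII_conj c.2)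

end LYRep.Intertwines

/-! ### Morphisms of crossed homomorphisms and cohomology -/

namespace CrossedHomMor

variable {G : LieYamaguti K L} {A : LieYamaguti K M} {act : LYAction G A} {H' H : CrossedHom act}

theorem comm_apply (ψ : CrossedHomMor H' H) (x : L) : ψ.ψh (H'.H x) = H.H (ψ.ψg x) :=
  LinearMap.congr_fun ψ.comm x

/-- In `[H'θx, u]` and `⟦u, H'θx, H'θy⟧`, applying `ψ_𝔥` turns `H'θx` into `Hψ_𝔤θx = Hx`. The
summands from `ρ` and `μ` are handled by equivariance together with the same cancellation `ψ_𝔤θ =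
1`. -/
theorem intertwines (ψ : CrossedHomMor H' H) (hψ : Function.Bijective ψ.ψg) :
    H'.rep.Intertwines H.rep (LinearEquiv.ofBijective ψ.ψg hψ).symm ψ.ψh := by
  have hs : ∀ x, ψ.ψg ((LinearEquiv.ofBijective ψ.ψg hψ).symm x) = x :=
    (LinearEquiv.ofBijective ψ.ψg hψ).apply_symm_apply
  -- The inverse preserves the brackets because both sides agree after applying the injective
  -- homomorphism `ψ_𝔤`.
  refine ⟨⟨fun x y => hψ.1 ?_, fun x y z => hψ.1 ?_⟩, fun x u => ?_, fun x y u => ?_⟩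
  · simp only [LinearEquiv.coe_coe, ψ.isHom_g.1, hs]
  · simp only [LinearEquiv.coe_coe, ψ.isHom_g.2, hs]
  · change ψ.ψh (H'.rhoH _ u) = H.rhoH x (ψ.ψh u)
    simp only [CrossedHom.rhoH_apply, LinearEquiv.coe_coe, map_add, ψ.isHom_h.1, ψ.map_rho,
      ψ.comm_apply, hs]
  · change ψ.ψh (H'.muH _ _ u) = H.muH x y (ψ.ψh u)
    simp only [CrossedHom.muH_apply, LinearEquiv.coe_coe, map_add, ψ.isHom_h.2, ψ.map_mu,
      ψ.comm_apply, hs]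

/-- `p` is a cochain map in positive degrees. -/
theorem coboundary_comp_p (ψ : CrossedHomMor H' H) (hψ : Function.Bijective ψ.ψg) (n : ℕ) :
    H.coboundary (n + 1) ∘ₗ ψ.p hψ n = ψ.p hψ (n + 1) ∘ₗ H'.coboundary (n + 1) :=
  (ψ.intertwines hψ).coboundary_conj n

/-- This is the square missing in degree `0`, needed for 1-coboundaries. Degree-`0` cochains are
elements of `⋀²𝔤`, not functions on it, so they are pushed forward by `ψ_𝔤` itself; the inverse
enters only through the variable `z`, where `ψ_𝔤` cancels it. -/
theorem deltaZero_map (ψ : CrossedHomMor H' H) (hψ : Function.Bijective ψ.ψg) (X : ⋀[K]^2 L) :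
    H.deltaZero (exteriorPower.map 2 ψ.ψg X)
      = conjHom (LinearEquiv.ofBijective ψ.ψg hψ).symm ψ.ψh (H'.deltaZero X) := by
  have hs : ∀ x, ψ.ψg ((LinearEquiv.ofBijective ψ.ψg hψ).symm x) = x :=
    (LinearEquiv.ofBijective ψ.ψg hψ).apply_symm_apply
  suffices e : H.deltaZero ∘ₗ exteriorPower.map 2 ψ.ψg
      = conjHom (LinearEquiv.ofBijective ψ.ψg hψ).symm ψ.ψh ∘ₗ H'.deltaZero from
    LinearMap.congr_fun e X
  refine wedge_ext fun x y => LinearMap.ext fun z => ?_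
  simp only [LinearMap.comp_apply, conjHom_apply, map_wedge, CrossedHom.deltaZero_apply,
    LinearEquiv.coe_coe, map_add, map_sub, ψ.isHom_h.2, ψ.map_mu, ψ.comm_apply, hs]

theorem p_mem_cocycles (ψ : CrossedHomMor H' H) (hψ : Function.Bijective ψ.ψg) (n : ℕ)
    {c : Cochain K L M (n + 1)} (hc : c ∈ H'.cocycles (n + 1)) :
    ψ.p hψ n c ∈ H.cocycles (n + 1) := by
  have hc : H'.coboundary (n + 1) c = 0 := hc
  have h := LinearMap.congr_fun (ψ.coboundary_comp_p hψ n) c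
  rw [LinearMap.comp_apply, LinearMap.comp_apply, hc, map_zero] at h
  exact h

theorem p_mem_coboundaries (ψ : CrossedHomMor H' H) (hψ : Function.Bijective ψ.ψg) :
    ∀ (n : ℕ) {c : Cochain K L M (n + 1)}, c ∈ H'.coboundaries (n + 1) →
      ψ.p hψ n c ∈ H.coboundaries (n + 1)
  -- A primitive `X` in `⋀²𝔤` is transported by `⋀²ψ_𝔤`; in higher degrees `p` transports the
  -- primitive.
  | 0, _, ⟨X, hX⟩ => ⟨exteriorPower.map 2 ψ.ψg X, by
      rw [← hX]; exact ψ.deltaZero_map hψ X⟩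
  | n + 1, _, ⟨b, hb⟩ => ⟨ψ.p hψ n b, by
      rw [← hb]; exact LinearMap.congr_fun (ψ.coboundary_comp_p hψ n) b⟩

end CrossedHomMor

end Intertwining

theorem mainTheorem8 {K g h : Type u} [Field K] [CharZero K]
    [AddCommGroup g] [Module K g] [FiniteDimensional K g]
    [AddCommGroup h] [Module K h] [FiniteDimensional K h]
    (G : LieYamaguti K g) (A : LieYamaguti K h) (act : LYAction G A)
    (H' H : CrossedHom act) (ψ : CrossedHomMor H' H) (hψ : Function.Bijective ψ.ψg) :
    (∀ n : ℕ, H.coboundary (n + 1) ∘ₗ ψ.p hψ n = ψ.p hψ (n + 1) ∘ₗ H'.coboundary (n + 1)) ∧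
    ∀ n : ℕ, ∃ hp : ∀ c ∈ H'.cocycles (n + 1), ψ.p hψ n c ∈ H.cocycles (n + 1),
      ∃! pStar : H'.Cohomology (n + 1) →ₗ[K] H.Cohomology (n + 1),
        ∀ c : H'.cocycles (n + 1),
          pStar (Submodule.Quotient.mk c) = Submodule.Quotient.mk ⟨ψ.p hψ n c, hp c c.2⟩ := by
  refine ⟨ψ.coboundary_comp_p hψ, fun n => ⟨fun c hc => ψ.p_mem_cocycles hψ n hc, ?_⟩⟩
  -- The induced map is the descent of `p` restricted to cocycles, which is legitimate because
  -- coboundaries go to coboundaries. On representatives it is `p` by definition.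
  refine ⟨Submodule.mapQ _ _
    ((ψ.p hψ n).restrict fun c hc => ψ.p_mem_cocycles hψ n hc) fun c hc =>
      ψ.p_mem_coboundaries hψ n hc, fun c => rfl, fun q hq => ?_⟩
  -- Uniqueness: a linear map out of the quotient is determined by its values on classes of
  -- cocycles.
  refine Submodule.linearMap_qext _ (LinearMap.ext fun c => ?_)
  exact hq c
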